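/- Let $a<a_1<b_1<b$, $\Omega=(a,b)$, $\Omega_1=(a_1,b_1)$, $\Omega_2=(a,a_1)\cup(b_1,b)$. Let $\alpha,\beta,\gamma>0$ and $\kappa\ge 0$ be constants, $h,q\in L^2(\Omega)$ and $g\in H^1(\Omega)$. Let $u_0\in H^1(\Omega)$ be the solution of the two-sided problem with Robin transmission condition: writing $u_1=u_0|_{\Omega_1}$, $u_2=u_0|_{\Omega_2}$, $$-u_1''+\gamma u_1=q\ \text{ in }\Omega_1,\qquad -\alpha u_2''+\beta u_2=h\ \text{ in }\Omega_2,$$ $$u_1=u_2\ \text{ and }\ -(u_1'-\alpha u_2')\,n_1=\kappa u_1+g\ \text{ on }\partial\Omega_1=\{a_1,b_1\},\qquad \alpha u_2'\,n_2=0\ \text{ on }\partial\Omega=\{a,b\},$$ where $n_1(a_1)=-1$, $n_1(b_1)=1$, $n_2(a)=-1$, $n_2(b)=1$; the equations hold almost everywhere with weak second derivatives, and boundary values are those of the continuous representatives. For $\varepsilon\in(0,1)$ let $\phi_\varepsilon(x)=\frac12\left[1+\tanh\left(r(x)/\varepsilon\right)\right]$, where $r$ is the signed distance to $\partial\Omega_1$,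 positive in $\Omega_1$ and negative outside $\overline{\Omega_1}$, and put $D_\varepsilon=\alpha+(1-\alpha)\phi_\varepsilon$, $c_\varepsilon=\beta+(\gamma-\beta)\phi_\varepsilon$, $f_\varepsilon=h+(q-h)\phi_\varepsilon$. Let $u_\varepsilon\in H^1(\Omega)$ be the solution of the diffuse domain problem, i.e. $$\int_\Omega\left(D_\varepsilon u_\varepsilon' v'+c_\varepsilon u_\varepsilon v+(\kappa u_\varepsilon+g)|\phi_\varepsilon'|\,v\right)dx=\int_\Omega f_\varepsilon v\,dx\qquad\text{for all }v\in H^1(\Omega).$$ Then for every sequence $(\varepsilon_k)\subset(0,1)$ with $\varepsilon_k\to0$ there is a subsequence of $(u_{\varepsilon_k})$ that converges strongly to $u_0$ in $H^1(\Omega)$. -/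

import Mathlib

open MeasureTheory Set Filter Topology
open scoped ContDiff

noncomputable section

namespace DiffuseDomain

/-- `w'` is the weak (distributional) derivative of `w` on the open set `Ω ⊆ ℝ`. -/
structure HasWeakDeriv (Ω : Set ℝ) (w w' : ℝ → ℝ) : Prop where
  locInt : LocallyIntegrableOn w Ω
  locInt_deriv : LocallyIntegrableOn w' Ω
  integral_eq : ∀ ψ : ℝ → ℝ, ContDiff ℝ ∞ ψ → HasCompactSupport ψ → tsupport ψ ⊆ Ω →
    ∫ x in Ω, w x * deriv ψ x = - ∫ x in Ω, w' x * ψ x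

/-- An element of the Sobolev space `H¹(Ω)`: a function in `L²(Ω)` together with its weak
derivative in `L²(Ω)`. Functions are represented by functions on `ℝ`, of which only the
almost-everywhere class on `Ω` matters. -/
structure H1 (Ω : Set ℝ) where
  toFun : ℝ → ℝ
  grad : ℝ → ℝ
  memLp : MemLp toFun 2 (volume.restrict Ω)
  memLp_grad : MemLp grad 2 (volume.restrict Ω)
  hasWeakDeriv : HasWeakDeriv Ω toFun grad

instance (Ω : Set ℝ) : CoeFun (H1 Ω) (fun _ => ℝ → ℝ) := ⟨H1.toFun⟩

/-- `‖u - v‖_{H¹(Ω)}`. -/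
def H1.dist {Ω : Set ℝ} (u v : H1 Ω) : ℝ :=
  Real.sqrt ((∫ x in Ω, (u x - v x) ^ 2) + ∫ x in Ω, (u.grad x - v.grad x) ^ 2)

/-- `w` is a representative, continuous on the closure of `Ω`, of the almost-everywhere class
of `v` on `Ω`; its values at boundary or interface points are the traces of `v`. -/
def IsContRep (Ω : Set ℝ) (v w : ℝ → ℝ) : Prop :=
  ContinuousOn w (closure Ω) ∧ w =ᵐ[volume.restrict Ω] v

/-- The data of the problem in one dimension. -/
structure Data where
  (a a₁ b₁ b : ℝ)
  (α β γ κ : ℝ)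
  (h q : ℝ → ℝ)
  g : H1 (Ioo a b)
  a_lt : a < a₁
  a₁_lt : a₁ < b₁
  b₁_lt : b₁ < b
  α_pos : 0 < α
  β_pos : 0 < β
  γ_pos : 0 < γ
  κ_nonneg : 0 ≤ κ
  h_memLp : MemLp h 2 (volume.restrict (Ioo a b))
  q_memLp : MemLp q 2 (volume.restrict (Ioo a b))

namespace Data

variable (P : Data)

/-- The whole domain `Ω = (a, b)`. -/
def Ω : Set ℝ := Ioo P.a P.b

/-- The inner domain `Ω₁ = (a₁, b₁)`. -/
def Ω₁ : Set ℝ := Ioo P.a₁ P.b₁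

/-- The outer domain `Ω₂ = (a, a₁) ∪ (b₁, b)`. -/
def Ω₂ : Set ℝ := Ioo P.a P.a₁ ∪ Ioo P.b₁ P.b

open Classical in
/-- The signed distance to `∂Ω₁`, positive in `Ω₁`, negative outside its closure. -/
def r (x : ℝ) : ℝ :=
  if x ∈ P.Ω₁ then Metric.infDist x (frontier P.Ω₁) else - Metric.infDist x (frontier P.Ω₁)

/-- The phase-field function. -/
def φ (ε x : ℝ) : ℝ := (1 / 2) * (1 + Real.tanh (P.r x / ε))

def D (ε x : ℝ) : ℝ := P.α + (1 - P.α) * P.φ ε x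

def c (ε x : ℝ) : ℝ := P.β + (P.γ - P.β) * P.φ ε x

def f (ε x : ℝ) : ℝ := P.h x + (P.q x - P.h x) * P.φ ε x

/-- `u ∈ H¹(Ω)` is the (weak) solution of the diffuse domain problem
`-(D_ε u')' + c_ε u + (κ u + g) |φ_ε'| = f_ε` in `Ω`, `D_ε u' = 0` on `∂Ω`.
The function `φ_ε` is Lipschitz and differentiable off the midpoint of `Ω₁`. -/
def IsDiffuseSolution (ε : ℝ) (u : H1 P.Ω) : Prop :=
  ∀ v : H1 P.Ω,
    ∫ x in P.Ω, (P.D ε x * u.grad x * v.grad x + P.c ε x * u x * v x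
        + (P.κ * u x + P.g x) * |deriv (P.φ ε) x| * v x)
      = ∫ x in P.Ω, P.f ε x * v x

/-- `u ∈ H¹(Ω)` is the solution of the two-sided problem, with `u₁ = u|_{Ω₁}`, `u₂ = u|_{Ω₂}`.
The equations hold with weak second derivatives. The functions `u₁'` and `u₂'` then have
continuous representatives `p₁`, `p₂` up to the boundary, which give the fluxes on `∂Ω₁` and `∂Ω`;
the values of `u` and `g` on `∂Ω₁` are those of their continuous representatives `w`, `gc`. The
condition `u₁ = u₂` on `∂Ω₁` is the continuity of `w` on the closure of `Ω`. The outward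
normals are `-1` at `a₁` and `a`, and `1` at `b₁` and `b`. -/
def IsTwoSidedSolution (u : H1 P.Ω) : Prop :=
  (∃ u₁'' : ℝ → ℝ, HasWeakDeriv P.Ω₁ u.grad u₁'' ∧
    ∀ᵐ x ∂(volume.restrict P.Ω₁), - u₁'' x + P.γ * u x = P.q x) ∧
  (∃ u₂'' : ℝ → ℝ, HasWeakDeriv P.Ω₂ u.grad u₂'' ∧
    ∀ᵐ x ∂(volume.restrict P.Ω₂), - P.α * u₂'' x + P.β * u x = P.h x) ∧
  ∃ w gc p₁ p₂ : ℝ → ℝ,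
    IsContRep P.Ω u w ∧ IsContRep P.Ω P.g gc ∧
    IsContRep P.Ω₁ u.grad p₁ ∧ IsContRep P.Ω₂ u.grad p₂ ∧
    - (p₁ P.a₁ - P.α * p₂ P.a₁) * (-1) = P.κ * w P.a₁ + gc P.a₁ ∧
    - (p₁ P.b₁ - P.α * p₂ P.b₁) * 1 = P.κ * w P.b₁ + gc P.b₁ ∧
    P.α * p₂ P.a * (-1) = 0 ∧
    P.α * p₂ P.b * 1 = 0

end Data

end DiffuseDomain

end

/-! The argument is a consistency-plus-coercivity estimate; no compactness is used, and the whole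
sequence converges. Insert $u_0$ into the diffuse problem. Integrating the two-sided equations by
parts over $(a,a_1)$, $(a_1,b_1)$, $(b_1,b)$ gives the same weak form with $\phi_\varepsilon$
replaced by the indicator $\chi$ of $\Omega_1$ and $|\phi_\varepsilon'|$ by Dirac masses at
$a_1,b_1$ (`IsTwoSidedSolution.weak_form`). In one dimension
$|\phi_\varepsilon'|=\pm\phi_\varepsilon'$ on either side of the midpoint of $\Omega_1$, so one
integration by parts turns the interface error into integrals against $\phi_\varepsilon-\chi$ plus
point values at $a$, $b$ and the midpoint (`integral_abs_deriv_φ_mul`). The residual is thus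
$\int(\phi_\varepsilon-\chi)(Av'+Bv)$ plus these point terms, with $A,B\in L^2$ independent of
$\varepsilon$ and $v$. Dominated convergence and the Sobolev inequality bound it by
$\delta_k\|v\|_{H^1}$ with $\delta_k\to0$ (`exists_residual_le`). The diffuse form is coercive
uniformly in $\varepsilon$, since $D_\varepsilon,c_\varepsilon$ are convex combinations of positive
constants and $\kappa|\phi_\varepsilon'|\ge0$. Testing with $v=u_\varepsilon-u_0$ gives
$\|u_\varepsilon-u_0\|_{H^1}\le C|\delta_k|$. -/

namespace DiffuseDomain

/-- `W` is a primitive of the integrable function `w` on `[a, b]`. -/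
structure IsPrimitiveOn (a b : ℝ) (W w : ℝ → ℝ) : Prop where
  intervalIntegrable : IntervalIntegrable w volume a b
  eq_add : ∀ x ∈ Icc a b, W x = W a + ∫ t in a..x, w t

/-! ### Calculus of primitives of integrable functions -/

namespace IsPrimitiveOn

variable {a b c d : ℝ} {F f G g : ℝ → ℝ}

lemma sub_eq (hF : IsPrimitiveOn a b F f) {x y : ℝ} (hx : x ∈ Icc a b) (hy : y ∈ Icc a b) :
    F y - F x = ∫ t in x..y, f t := by
  have hab : a ≤ b := hx.1.trans hx.2
  have h1 : IntervalIntegrable f volume a x :=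
    hF.intervalIntegrable.mono_set (by
      rw [uIcc_of_le hab, uIcc_of_le hx.1]; exact Icc_subset_Icc_right hx.2)
  have h2 : IntervalIntegrable f volume a y :=
    hF.intervalIntegrable.mono_set (by
      rw [uIcc_of_le hab, uIcc_of_le hy.1]; exact Icc_subset_Icc_right hy.2)
  rw [hF.eq_add x hx, hF.eq_add y hy, ← intervalIntegral.integral_interval_sub_left h2 h1]
  ring

lemma mono (hF : IsPrimitiveOn a b F f) (hac : a ≤ c) (hcd : c ≤ d) (hdb : d ≤ b) :
    IsPrimitiveOn c d F f where
  intervalIntegrable := hF.intervalIntegrable.mono_set (by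
    rw [uIcc_of_le (hac.trans (hcd.trans hdb)), uIcc_of_le hcd]; exact Icc_subset_Icc hac hdb)
  eq_add x hx := by
    rw [← hF.sub_eq ⟨hac, hcd.trans hdb⟩ ⟨hac.trans hx.1, hx.2.trans hdb⟩]
    ring

lemma congr_ae (hF : IsPrimitiveOn a b F f) (hab : a ≤ b)
    (h : f =ᵐ[volume.restrict (Ioo a b)] g) : IsPrimitiveOn a b F g := by
  have h' : ∀ᵐ t, t ∈ Ioc a b → f t = g t := by
    rw [← ae_restrict_iff' measurableSet_Ioc, ← restrict_Ioo_eq_restrict_Ioc]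
    exact h
  refine ⟨hF.intervalIntegrable.congr_ae ?_, fun x hx => ?_⟩
  · rw [uIoc_of_le hab, ← restrict_Ioo_eq_restrict_Ioc]; exact h
  · rw [hF.eq_add x hx]
    congr 1
    apply intervalIntegral.integral_congr_ae
    filter_upwards [h'] with t ht htx
    rw [uIoc_of_le hx.1] at htx
    exact ht ⟨htx.1, htx.2.trans hx.2⟩

lemma congr (hF : IsPrimitiveOn a b F f) (hab : a ≤ b) (h : EqOn F G (Icc a b)) :
    IsPrimitiveOn a b G f :=
  ⟨hF.intervalIntegrable, fun x hx => by
    rw [← h hx, ← h (left_mem_Icc.2 hab), hF.eq_add x hx]⟩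

/-- The explicit formula is used instead of `F`, which is unconstrained off $[a,b]$; its derivative
comes directly from Lebesgue differentiation. -/
lemma absolutelyContinuousOnInterval (hF : IsPrimitiveOn a b F f) :
    AbsolutelyContinuousOnInterval (fun x => F a + ∫ t in a..x, f t) a b :=
  ((LipschitzWith.const (F a)).lipschitzOnWith.absolutelyContinuousOnInterval).fun_add
    (hF.intervalIntegrable.absolutelyContinuousOnInterval_intervalIntegral (c := a) (by simp))

lemma continuousOn (hF : IsPrimitiveOn a b F f) (hab : a ≤ b) : ContinuousOn F (Icc a b) := by
  have := hF.absolutelyContinuousOnInterval.continuousOn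
  rw [uIcc_of_le hab] at this
  exact this.congr hF.eq_add

/-- Integration by parts. -/
lemma integral_mul_add_mul (hF : IsPrimitiveOn a b F f) (hG : IsPrimitiveOn a b G g)
    (hab : a ≤ b) :
    ∫ x in a..b, (f x * G x + F x * g x) = F b * G b - F a * G a := by
  have h := hF.absolutelyContinuousOnInterval.integral_deriv_mul_eq_sub
    hG.absolutelyContinuousOnInterval
  simp only [intervalIntegral.integral_same, add_zero] at h
  rw [← hF.eq_add b (right_mem_Icc.2 hab), ← hG.eq_add b (right_mem_Icc.2 hab)] at h
  rw [← h]
  apply intervalIntegral.integral_congr_ae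
  filter_upwards [hF.intervalIntegrable.ae_hasDerivAt_integral,
    hG.intervalIntegrable.ae_hasDerivAt_integral] with x hx1 hx2 hx
  have hx' := uIoc_subset_uIcc hx
  rw [((hx1 hx' a (by simp)).const_add (F a)).deriv, ((hx2 hx' a (by simp)).const_add (G a)).deriv]
  rw [uIcc_of_le hab] at hx'
  rw [← hF.eq_add x hx', ← hG.eq_add x hx']

lemma mul (hF : IsPrimitiveOn a b F f) (hG : IsPrimitiveOn a b G g) (hab : a ≤ b) :
    IsPrimitiveOn a b (fun x => F x * G x) (fun x => f x * G x + F x * g x) where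
  intervalIntegrable :=
    (hF.intervalIntegrable.mul_continuousOn (by
      rw [uIcc_of_le hab]; exact hG.continuousOn hab)).add
    (hG.intervalIntegrable.continuousOn_mul (by
      rw [uIcc_of_le hab]; exact hF.continuousOn hab))
  eq_add x hx := by
    rw [(hF.mono le_rfl hx.1 hx.2).integral_mul_add_mul (hG.mono le_rfl hx.1 hx.2) hx.1]
    ring

lemma add (hF : IsPrimitiveOn a b F f) (hG : IsPrimitiveOn a b G g) :
    IsPrimitiveOn a b (fun x => F x + G x) (fun x => f x + g x) where
  intervalIntegrable := hF.intervalIntegrable.add hG.intervalIntegrable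
  eq_add x hx := by
    rw [intervalIntegral.integral_add
      (hF.mono le_rfl hx.1 hx.2).intervalIntegrable (hG.mono le_rfl hx.1 hx.2).intervalIntegrable,
      hF.eq_add x hx, hG.eq_add x hx]
    ring

lemma const_mul (hF : IsPrimitiveOn a b F f) (k : ℝ) :
    IsPrimitiveOn a b (fun x => k * F x) (fun x => k * f x) where
  intervalIntegrable := hF.intervalIntegrable.const_mul k
  eq_add x hx := by
    rw [intervalIntegral.integral_const_mul, hF.eq_add x hx]
    ring

lemma of_hasDerivAt (hF : ∀ x ∈ Icc a b, HasDerivAt F (f x) x) (hf : ContinuousOn f (Icc a b))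
    (hab : a ≤ b) : IsPrimitiveOn a b F f where
  intervalIntegrable := ContinuousOn.intervalIntegrable (by rwa [uIcc_of_le hab])
  eq_add x hx := by
    rw [intervalIntegral.integral_eq_sub_of_hasDerivAt (f := F)]
    · ring
    · intro y hy
      rw [uIcc_of_le hx.1] at hy
      exact hF y ⟨hy.1, hy.2.trans hx.2⟩
    · apply ContinuousOn.intervalIntegrable
      rw [uIcc_of_le hx.1]
      exact hf.mono (Icc_subset_Icc_right hx.2)

end IsPrimitiveOn

/-! ### Weak derivatives on an interval and continuous representatives -/

lemma exists_Icc_of_tsupport_subset_Ioo {a b : ℝ} (hab : a < b) {ψ : ℝ → ℝ}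
    (hc : HasCompactSupport ψ) (hs : tsupport ψ ⊆ Ioo a b) :
    ∃ c d, a < c ∧ c ≤ d ∧ d < b ∧ tsupport ψ ⊆ Icc c d := by
  rcases (tsupport ψ).eq_empty_or_nonempty with h | h
  · exact ⟨(a + b) / 2, (a + b) / 2, by linarith, le_rfl, by linarith, by simp [h]⟩
  · have hk : IsCompact (tsupport ψ) := hc
    exact ⟨sInf (tsupport ψ), sSup (tsupport ψ), (hs (hk.sInf_mem h)).1,
      csInf_le hk.bddBelow (hk.sSup_mem h), (hs (hk.sSup_mem h)).2,
      fun x hx => ⟨csInf_le hk.bddBelow hx, le_csSup hk.bddAbove hx⟩⟩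

/-- A test function with zero mean is the derivative of a test function. -/
lemma exists_testFunction_deriv_eq {a b : ℝ} (hab : a < b) {ψ : ℝ → ℝ} (hψ : ContDiff ℝ ∞ ψ)
    (hc : HasCompactSupport ψ) (hs : tsupport ψ ⊆ Ioo a b) (h0 : ∫ x in Ioo a b, ψ x = 0) :
    ∃ Ψ : ℝ → ℝ, ContDiff ℝ ∞ Ψ ∧ HasCompactSupport Ψ ∧ tsupport Ψ ⊆ Ioo a b ∧ deriv Ψ = ψ := by
  obtain ⟨c, d, hac, hcd, hdb, hcs⟩ := exists_Icc_of_tsupport_subset_Ioo hab hc hs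
  have hderiv : ∀ x, HasDerivAt (fun x => ∫ t in a..x, ψ t) (ψ x) x := fun x =>
    intervalIntegral.integral_hasDerivAt_right (hψ.continuous.intervalIntegrable _ _)
      hψ.continuous.stronglyMeasurable.stronglyMeasurableAtFilter hψ.continuous.continuousAt
  have hd : deriv (fun x => ∫ t in a..x, ψ t) = ψ := funext fun x => (hderiv x).deriv
  have hzero : ∀ t, t ∉ Icc c d → ψ t = 0 := fun t ht =>
    image_eq_zero_of_notMem_tsupport fun h => ht (hcs h)
  have htot : ∫ t in a..b, ψ t = 0 := by
    rw [intervalIntegral.integral_of_le hab.le, integral_Ioc_eq_integral_Ioo, h0]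
  -- Left of $c$ nothing has been integrated yet; right of $d$ the whole mean has, and it is zero.
  have hsub : Function.support (fun x => ∫ t in a..x, ψ t) ⊆ Icc c d := by
    intro x hx
    by_contra hxn
    apply hx
    rw [mem_Icc, not_and_or, not_le, not_le] at hxn
    rcases hxn with hxc | hxd
    · apply intervalIntegral.integral_zero_ae
      refine ae_of_all _ fun t ht => hzero t fun h => ?_
      have := uIoc_subset_uIcc ht
      have h2 := this.2
      rcases le_sup_iff.1 h2 with h3 | h3 <;> linarith [h.1]
    · show ∫ t in a..x, ψ t = 0
      rw [← intervalIntegral.integral_add_adjacent_intervals (b := b)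
        (hψ.continuous.intervalIntegrable _ _) (hψ.continuous.intervalIntegrable _ _), htot, zero_add]
      apply intervalIntegral.integral_zero_ae
      refine ae_of_all _ fun t ht => hzero t fun h => ?_
      have := uIoc_subset_uIcc ht
      rcases inf_le_iff.1 this.1 with h3 | h3 <;> linarith [h.2]
  refine ⟨_, ?_, HasCompactSupport.of_support_subset_isCompact isCompact_Icc hsub,
    (closure_minimal hsub isClosed_Icc).trans (Icc_subset_Ioo hac hdb), hd⟩
  rw [contDiff_infty_iff_deriv, hd]
  exact ⟨fun x => (hderiv x).differentiableAt, hψ⟩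

lemma integrableOn_mul_testFunction {U : Set ℝ} (hU : MeasurableSet U) {z ψ : ℝ → ℝ}
    (hz : LocallyIntegrableOn z U)
    (hψ : Continuous ψ) (hc : HasCompactSupport ψ) (hs : tsupport ψ ⊆ U) :
    IntegrableOn (fun x => z x * ψ x) U := by
  have h1 : IntegrableOn (fun x => z x * ψ x) (tsupport ψ) :=
    (hz.integrableOn_compact_subset hs hc).mul_continuousOn hψ.continuousOn hc
  refine (h1.of_forall_sdiff_eq_zero hU ?_)
  intro x hx
  rw [image_eq_zero_of_notMem_tsupport hx.2, mul_zero]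

/-- The lemma of du Bois-Reymond. -/
lemma ae_eq_const_of_integral_mul_deriv_eq_zero {a b : ℝ} (hab : a < b) {z : ℝ → ℝ}
    (hz : LocallyIntegrableOn z (Ioo a b))
    (h : ∀ ψ : ℝ → ℝ, ContDiff ℝ ∞ ψ → HasCompactSupport ψ → tsupport ψ ⊆ Ioo a b →
      ∫ x in Ioo a b, z x * deriv ψ x = 0) :
    ∃ C : ℝ, ∀ᵐ x ∂volume.restrict (Ioo a b), z x = C := by
  obtain ⟨η, hηs, hηc, hηd, hη1⟩ : ∃ η : ℝ → ℝ, tsupport η ⊆ Ioo a b ∧ HasCompactSupport η ∧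
      ContDiff ℝ ∞ η ∧ ∫ x in Ioo a b, η x = 1 := by
    let φ : ContDiffBump ((a + b) / 2) := ⟨(b - a) / 8, (b - a) / 4, by linarith, by linarith⟩
    have hs : tsupport (φ.normed volume) ⊆ Ioo a b := by
      rw [φ.tsupport_normed_eq, Real.closedBall_eq_Icc]
      apply Icc_subset_Ioo <;> simp only [φ] <;> linarith
    refine ⟨φ.normed volume, hs, φ.hasCompactSupport_normed, φ.contDiff_normed, ?_⟩
    rw [setIntegral_eq_integral_of_forall_compl_eq_zero, φ.integral_normed]
    intro x hx
    exact image_eq_zero_of_notMem_tsupport fun h => hx (hs h)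
  set C := ∫ x in Ioo a b, z x * η x
  refine ⟨C, ?_⟩
  have key := isOpen_Ioo.ae_eq_zero_of_integral_contDiff_smul_eq_zero (μ := volume)
    (f := fun x => z x - C) (U := Ioo a b)
    (hz.sub (locallyIntegrableOn_const C)) ?_
  · rw [ae_restrict_iff' measurableSet_Ioo]
    filter_upwards [key] with x hx hxm using by linarith [hx hxm]
  · intro ψ hψ hψc hψs
    have h_integrable : IntegrableOn ψ (Ioo a b) :=
      (hψ.continuous.integrable_of_hasCompactSupport hψc).integrableOn
    have hηint : IntegrableOn η (Ioo a b) :=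
      (hηd.continuous.integrable_of_hasCompactSupport hηc).integrableOn
    set I := ∫ x in Ioo a b, ψ x with hI
    have hsupp : tsupport (fun x => ψ x - I * η x) ⊆ tsupport ψ ∪ tsupport η := by
      refine closure_minimal ?_ ((isClosed_tsupport _).union (isClosed_tsupport _))
      intro x hx
      by_contra hxn
      rw [mem_union, not_or] at hxn
      apply hx
      simp [image_eq_zero_of_notMem_tsupport hxn.1, image_eq_zero_of_notMem_tsupport hxn.2]
    -- Since $\int\eta=1$, subtracting $I\eta$ removes the mean of $\psi$, so the hypothesis applies
    -- to an antiderivative.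
    obtain ⟨Ψ, hΨ, hΨc, hΨs, hΨd⟩ := exists_testFunction_deriv_eq hab
      (ψ := fun x => ψ x - I * η x) (hψ.sub (contDiff_const.mul hηd))
      (HasCompactSupport.of_support_subset_isCompact (IsCompact.union hψc hηc)
        ((subset_tsupport _).trans hsupp))
      (hsupp.trans (union_subset hψs hηs))
      (by rw [integral_sub h_integrable (hηint.const_mul _), integral_const_mul, hη1]; ring)
    have h1 := h Ψ hΨ hΨc hΨs
    rw [hΨd] at h1
    have i1 := integrableOn_mul_testFunction measurableSet_Ioo hz hψ.continuous hψc hψs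
    have i2 := integrableOn_mul_testFunction measurableSet_Ioo hz hηd.continuous hηc hηs
    have h2 : ∫ x in Ioo a b, z x * ψ x = I * C := by
      have : ∫ x in Ioo a b, (z x * ψ x - I * (z x * η x)) = 0 := by
        rw [← h1]; congr 1; ext x; ring
      rw [integral_sub i1 (i2.const_mul _), integral_const_mul] at this
      linarith
    rw [← setIntegral_eq_integral_of_forall_compl_eq_zero (s := Ioo a b)]
    · have : ∫ x in Ioo a b, ψ x • (z x - C) = ∫ x in Ioo a b, (z x * ψ x - C * ψ x) := by
        congr 1; ext x; simp only [smul_eq_mul]; ring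
      rw [this, integral_sub i1 (h_integrable.const_mul _), integral_const_mul, h2]
      ring
    · intro x hx
      rw [image_eq_zero_of_notMem_tsupport fun h => hx (hψs h), zero_smul]

lemma intervalIntegral_eq_integral_Ioo {a b : ℝ} (hab : a ≤ b) (f : ℝ → ℝ) :
    ∫ x in a..b, f x = ∫ x in Ioo a b, f x := by
  rw [intervalIntegral.integral_of_le hab, integral_Ioc_eq_integral_Ioo]

/-- A function with integrable weak derivative agrees almost everywhere with a primitive of it. -/
lemma HasWeakDeriv.exists_isPrimitiveOn {a b : ℝ} (hab : a < b) {w w' : ℝ → ℝ}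
    (h : HasWeakDeriv (Ioo a b) w w') (hw' : IntegrableOn w' (Ioo a b)) :
    ∃ W, IsPrimitiveOn a b W w' ∧ W =ᵐ[volume.restrict (Ioo a b)] w := by
  have hii : IntervalIntegrable w' volume a b := by
    rwa [intervalIntegrable_iff_integrableOn_Ioo_of_le hab.le]
  have hP : IsPrimitiveOn a b (fun x => ∫ t in a..x, w' t) w' := ⟨hii, by simp⟩
  have hPc := hP.continuousOn hab.le
  have hPl : LocallyIntegrableOn (fun x => ∫ t in a..x, w' t) (Ioo a b) :=
    (hPc.mono Ioo_subset_Icc_self).locallyIntegrableOn measurableSet_Ioo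
  -- The difference of `w` and a primitive of `w'` has zero weak derivative.
  obtain ⟨C, hC⟩ := ae_eq_const_of_integral_mul_deriv_eq_zero hab (h.locInt.sub hPl) (by
    intro ψ hψ hψc hψs
    have hz : ∀ x ∉ Ioo a b, ψ x = 0 := fun x hx =>
      image_eq_zero_of_notMem_tsupport fun h => hx (hψs h)
    have hψ' : Continuous (deriv ψ) := hψ.continuous_deriv (by simp)
    have hd's : tsupport (deriv ψ) ⊆ Ioo a b := tsupport_deriv_subset.trans hψs
    have hparts := hP.integral_mul_add_mul (IsPrimitiveOn.of_hasDerivAt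
      (F := ψ) (f := deriv ψ) (fun x _ => (hψ.differentiable (by simp) x).hasDerivAt)
      hψ'.continuousOn hab.le) hab.le
    rw [hz a (by simp), hz b (by simp), intervalIntegral_eq_integral_Ioo hab.le,
      integral_add (integrableOn_mul_testFunction measurableSet_Ioo h.locInt_deriv hψ.continuous
        hψc hψs) (integrableOn_mul_testFunction measurableSet_Ioo hPl hψ' hψc.deriv hd's)] at hparts
    have h3 := h.integral_eq ψ hψ hψc hψs
    simp only [Pi.sub_apply, sub_mul]
    rw [integral_sub (integrableOn_mul_testFunction measurableSet_Ioo h.locInt hψ' hψc.deriv hd's)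
      (integrableOn_mul_testFunction measurableSet_Ioo hPl hψ' hψc.deriv hd's), h3]
    linarith)
  refine ⟨fun x => C + ∫ t in a..x, w' t, ⟨hii, by simp⟩, ?_⟩
  filter_upwards [hC] with x hx
  simp only [Pi.sub_apply] at hx
  linarith

/-- Needed because $\Omega_2$ is disconnected and is treated one component at a time. -/
lemma HasWeakDeriv.mono {U V : Set ℝ} (hV : MeasurableSet V) (hUV : U ⊆ V)
    {w w' : ℝ → ℝ}
    (h : HasWeakDeriv V w w') : HasWeakDeriv U w w' where
  locInt := h.locInt.mono_set hUV
  locInt_deriv := h.locInt_deriv.mono_set hUV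
  integral_eq ψ hψ hc hs := by
    have e := h.integral_eq ψ hψ hc (hs.trans hUV)
    have hz : ∀ x ∈ V \ U, ψ x = 0 := fun x hx =>
      image_eq_zero_of_notMem_tsupport fun h => hx.2 (hs h)
    have hz' : ∀ x ∈ V \ U, deriv ψ x = 0 := fun x hx =>
      image_eq_zero_of_notMem_tsupport fun h => hx.2 (hs (tsupport_deriv_subset h))
    rw [setIntegral_eq_of_subset_of_forall_sdiff_eq_zero hV hUV
        (fun x hx => by rw [hz' x hx, mul_zero]),
      setIntegral_eq_of_subset_of_forall_sdiff_eq_zero hV hUV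
        (fun x hx => by rw [hz x hx, mul_zero])] at e
    exact e

/-- A continuous representative on a set containing `(a, b)` of a function with integrable weak
derivative is a primitive of that derivative. -/
lemma IsContRep.isPrimitiveOn {U : Set ℝ} (hU : MeasurableSet U) {a b : ℝ} (hab : a < b)
    (hsub : Ioo a b ⊆ U)
    {v w v' : ℝ → ℝ} (hw : IsContRep U v w) (h : HasWeakDeriv U v v')
    (hv' : IntegrableOn v' (Ioo a b)) : IsPrimitiveOn a b w v' := by
  obtain ⟨W, hW, hWv⟩ := (h.mono hU hsub).exists_isPrimitiveOn hab hv'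
  -- Continuous functions equal almost everywhere agree on all of $[a,b]$, so endpoint values, i.e.
  -- traces, carry over.
  refine hW.congr hab.le (Measure.eqOn_Icc_of_ae_eq (μ := volume) hab.ne ?_
    (hW.continuousOn hab.le) (hw.1.mono ?_))
  · rw [← restrict_Ioo_eq_restrict_Icc]
    filter_upwards [hWv, ae_restrict_of_ae_restrict_of_subset hsub hw.2] with x h1 h2
    rw [h1, h2]
  · rw [← closure_Ioo hab.ne]
    exact closure_mono hsub

/-! ### The tanh profile -/

lemma hasDerivAt_tanh (x : ℝ) : HasDerivAt Real.tanh (1 - Real.tanh x ^ 2) x := by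
  have h := (Real.hasDerivAt_sinh x).div (Real.hasDerivAt_cosh x) (Real.cosh_pos x).ne'
  have he : Real.tanh = Real.sinh / Real.cosh := funext Real.tanh_eq_sinh_div_cosh
  rw [← he] at h
  have e : 1 - Real.tanh x ^ 2 =
      (Real.cosh x * Real.cosh x - Real.sinh x * Real.sinh x) / Real.cosh x ^ 2 := by
    have := (Real.cosh_pos x).ne'
    rw [Real.tanh_eq_sinh_div_cosh]
    field_simp
  rwa [e]

lemma continuous_tanh : Continuous Real.tanh :=
  continuous_iff_continuousAt.2 fun x => (hasDerivAt_tanh x).continuousAt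

lemma tendsto_tanh_atTop : Tendsto Real.tanh atTop (𝓝 1) := by
  have h1 : Tendsto (fun x : ℝ => Real.exp (2 * x) + 1) atTop atTop :=
    tendsto_atTop_add_const_right _ _
      (Real.tendsto_exp_atTop.comp (tendsto_id.const_mul_atTop two_pos))
  have h2 : Tendsto (fun x : ℝ => 1 - 2 / (Real.exp (2 * x) + 1)) atTop (𝓝 (1 - 0)) :=
    tendsto_const_nhds.sub (tendsto_const_nhds.div_atTop h1)
  rw [sub_zero] at h2
  refine h2.congr fun x => ?_
  have hx := Real.exp_pos x
  have h3 : Real.exp (2 * x) = Real.exp x ^ 2 := by rw [two_mul, Real.exp_add, sq]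
  rw [Real.tanh_eq, h3, Real.exp_neg]
  field_simp
  ring

lemma tendsto_tanh_atBot : Tendsto Real.tanh atBot (𝓝 (-1)) := by
  have h := (tendsto_tanh_atTop.comp tendsto_neg_atBot_atTop).neg
  refine h.congr fun x => ?_
  simp [Real.tanh_neg]

/-! ### The phase field, its derivative and its sharp limit -/

namespace Data

variable (P : Data)

/-- The midpoint of `Ω₁`. -/
noncomputable def mid : ℝ := (P.a₁ + P.b₁) / 2

lemma a_lt_mid : P.a < P.mid := by unfold mid; linarith [P.a_lt, P.a₁_lt]
lemma mid_lt_b : P.mid < P.b := by unfold mid; linarith [P.b₁_lt, P.a₁_lt]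
lemma a₁_lt_mid : P.a₁ < P.mid := by unfold mid; linarith [P.a₁_lt]
lemma mid_lt_b₁ : P.mid < P.b₁ := by unfold mid; linarith [P.a₁_lt]
lemma a_lt_b : P.a < P.b := P.a_lt_mid.trans P.mid_lt_b

/-- Outside $\Omega_1$ the smaller of the two differences is the nonpositive one, minus the distance
to the nearer endpoint. -/
lemma r_eq_min (x : ℝ) : P.r x = min (x - P.a₁) (P.b₁ - x) := by
  have hd : Metric.infDist x (frontier P.Ω₁) = min |x - P.a₁| |x - P.b₁| := by
    have h1 := P.a₁_lt
    rw [Ω₁, frontier_Ioo h1, Metric.infDist_eq_iInf]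
    rw [← sInf_range]
    have hr : range (fun y : ({P.a₁, P.b₁} : Set ℝ) => dist x y) = {|x - P.a₁|, |x - P.b₁|} := by
      ext t
      simp [Real.dist_eq]
    rw [hr, csInf_pair]
  have h1 := P.a₁_lt
  unfold r
  rw [hd]
  split_ifs with hx
  · rw [abs_of_pos (by linarith [hx.1]), abs_of_neg (by linarith [hx.2]), neg_sub]
  · rw [Ω₁, mem_Ioo, not_and_or, not_lt, not_lt] at hx
    rcases hx with hx | hx
    · rw [abs_of_nonpos (by linarith), abs_of_neg (by linarith), min_eq_left (by linarith),
        min_eq_left (by linarith)]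
      ring
    · rw [abs_of_pos (by linarith), abs_of_nonneg (by linarith), min_eq_right (by linarith),
        min_eq_right (by linarith)]
      ring

lemma r_of_le_mid {x : ℝ} (hx : x ≤ P.mid) : P.r x = x - P.a₁ := by
  rw [r_eq_min, min_eq_left]; unfold mid at hx; linarith

lemma r_of_mid_le {x : ℝ} (hx : P.mid ≤ x) : P.r x = P.b₁ - x := by
  rw [r_eq_min, min_eq_right]; unfold mid at hx; linarith

lemma φ_pos (ε x : ℝ) : 0 < P.φ ε x := by
  unfold φ; linarith [Real.neg_one_lt_tanh (P.r x / ε)]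

lemma φ_lt_one (ε x : ℝ) : P.φ ε x < 1 := by
  unfold φ; linarith [Real.tanh_lt_one (P.r x / ε)]

lemma continuous_φ (ε : ℝ) : Continuous (P.φ ε) := by
  have hr : Continuous P.r := by
    rw [funext P.r_eq_min]; fun_prop
  unfold φ
  exact continuous_const.mul (continuous_const.add (continuous_tanh.comp (hr.div_const ε)))

/-- Used with $s=\pm1$, as $r$ is affine with slope $1$ left of the midpoint and $-1$ right of it.
-/
lemma hasDerivAt_profile (ε s c x : ℝ) :
    HasDerivAt (fun y => 1 / 2 * (1 + Real.tanh ((s * y + c) / ε)))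
      (1 / 2 * ((1 - Real.tanh ((s * x + c) / ε) ^ 2) * (s / ε))) x := by
  have h1 : HasDerivAt (fun y => (s * y + c) / ε) (s / ε) x := by
    simpa using (((hasDerivAt_id x).const_mul s).add_const c).div_const ε
  exact (((hasDerivAt_tanh _).comp x h1).const_add 1).const_mul (1 / 2)

lemma continuous_profile_deriv (ε s c : ℝ) :
    Continuous (fun x => 1 / 2 * ((1 - Real.tanh ((s * x + c) / ε) ^ 2) * (s / ε))) := by
  have h : Continuous (fun x => Real.tanh ((s * x + c) / ε)) :=
    continuous_tanh.comp (by fun_prop)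
  fun_prop

lemma deriv_φ_of_lt_mid (ε : ℝ) {x : ℝ} (hx : x < P.mid) :
    deriv (P.φ ε) x = 1 / 2 * ((1 - Real.tanh ((1 * x + -P.a₁) / ε) ^ 2) * (1 / ε)) := by
  refine ((hasDerivAt_profile ε 1 (-P.a₁) x).congr_of_eventuallyEq ?_).deriv
  filter_upwards [Iio_mem_nhds hx] with y hy
  rw [φ, P.r_of_le_mid (le_of_lt hy)]
  ring_nf

lemma deriv_φ_of_mid_lt (ε : ℝ) {x : ℝ} (hx : P.mid < x) :
    deriv (P.φ ε) x = 1 / 2 * ((1 - Real.tanh ((-1 * x + P.b₁) / ε) ^ 2) * (-1 / ε)) := by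
  refine ((hasDerivAt_profile ε (-1) P.b₁ x).congr_of_eventuallyEq ?_).deriv
  filter_upwards [Ioi_mem_nhds hx] with y hy
  rw [φ, P.r_of_mid_le (le_of_lt hy)]
  ring_nf

lemma one_sub_tanh_sq_mem (t : ℝ) : 1 - Real.tanh t ^ 2 ∈ Icc (0 : ℝ) 1 :=
  ⟨by linarith [Real.tanh_sq_lt_one t], by linarith [sq_nonneg (Real.tanh t)]⟩

/-- The two halves are kept apart because $\phi_\varepsilon$ has a corner at the midpoint, where its
slope changes sign. -/
lemma isPrimitiveOn_φ_left {ε : ℝ} (hε : 0 < ε) :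
    IsPrimitiveOn P.a P.mid (P.φ ε) (fun x => |deriv (P.φ ε) x|) := by
  refine ((IsPrimitiveOn.of_hasDerivAt (fun x _ => hasDerivAt_profile ε 1 (-P.a₁) x)
    (continuous_profile_deriv ε 1 (-P.a₁)).continuousOn P.a_lt_mid.le).congr P.a_lt_mid.le
      ?_).congr_ae P.a_lt_mid.le ?_
  · intro x hx
    simp only [φ]
    rw [P.r_of_le_mid hx.2]
    ring_nf
  · filter_upwards [ae_restrict_mem measurableSet_Ioo] with x hx
    rw [P.deriv_φ_of_lt_mid ε hx.2, abs_of_nonneg]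
    have := (one_sub_tanh_sq_mem ((1 * x + -P.a₁) / ε)).1
    positivity

lemma isPrimitiveOn_φ_right {ε : ℝ} (hε : 0 < ε) :
    IsPrimitiveOn P.mid P.b (P.φ ε) (fun x => -|deriv (P.φ ε) x|) := by
  refine ((IsPrimitiveOn.of_hasDerivAt (fun x _ => hasDerivAt_profile ε (-1) P.b₁ x)
    (continuous_profile_deriv ε (-1) P.b₁).continuousOn P.mid_lt_b.le).congr P.mid_lt_b.le
      ?_).congr_ae P.mid_lt_b.le ?_
  · intro x hx
    simp only [φ]
    rw [P.r_of_mid_le hx.1]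
    ring_nf
  · filter_upwards [ae_restrict_mem measurableSet_Ioo] with x hx
    rw [P.deriv_φ_of_mid_lt ε hx.1, abs_of_nonpos, neg_neg]
    have h1 := (one_sub_tanh_sq_mem ((-1 * x + P.b₁) / ε)).1
    rw [neg_div, mul_neg, mul_neg, neg_nonpos]
    positivity

/-- The bound blows up as $\varepsilon\to0$; it serves only for integrability at fixed
$\varepsilon$. -/
lemma ae_abs_deriv_φ_le {ε : ℝ} (hε : 0 < ε) : ∀ᵐ x, |deriv (P.φ ε) x| ≤ 1 / ε := by
  have hne : ∀ᵐ x : ℝ, x ≠ P.mid := by simp [ae_iff, measure_singleton]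
  filter_upwards [hne] with x hx
  rcases lt_or_gt_of_ne hx with h | h
  · rw [P.deriv_φ_of_lt_mid ε h, abs_mul, abs_mul, abs_of_nonneg (one_sub_tanh_sq_mem _).1,
      abs_of_pos (by positivity : (0 : ℝ) < 1 / ε)]
    have h1 := one_sub_tanh_sq_mem ((1 * x + -P.a₁) / ε)
    have h2 : (0 : ℝ) < 1 / ε := by positivity
    rw [abs_of_pos (by norm_num : (0 : ℝ) < 1 / 2)]
    nlinarith [h1.1, h1.2, mul_le_mul_of_nonneg_right h1.2 h2.le]
  · rw [P.deriv_φ_of_mid_lt ε h, abs_mul, abs_mul, abs_of_nonneg (one_sub_tanh_sq_mem _).1,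
      neg_div, abs_neg, abs_of_pos (by positivity : (0 : ℝ) < 1 / ε)]
    have h1 := one_sub_tanh_sq_mem ((-1 * x + P.b₁) / ε)
    have h2 : (0 : ℝ) < 1 / ε := by positivity
    rw [abs_of_pos (by norm_num : (0 : ℝ) < 1 / 2)]
    nlinarith [h1.1, h1.2, mul_le_mul_of_nonneg_right h1.2 h2.le]

/-- The indicator function of `Ω₁`, the sharp-interface limit of the phase field. -/
noncomputable def χ : ℝ → ℝ := P.Ω₁.indicator 1

lemma χ_of_mem {x : ℝ} (hx : x ∈ Ioo P.a₁ P.b₁) : P.χ x = 1 := indicator_of_mem hx _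

lemma χ_of_notMem {x : ℝ} (hx : x ∉ Ioo P.a₁ P.b₁) : P.χ x = 0 := indicator_of_notMem hx _

lemma measurable_χ : Measurable P.χ := measurable_one.indicator measurableSet_Ioo

lemma abs_φ_sub_χ_le (ε x : ℝ) : |P.φ ε x - P.χ x| ≤ 1 := by
  have h1 := P.φ_pos ε x
  have h2 := P.φ_lt_one ε x
  by_cases hx : x ∈ Ioo P.a₁ P.b₁
  · rw [P.χ_of_mem hx, abs_le]; constructor <;> linarith
  · rw [P.χ_of_notMem hx, abs_le]; constructor <;> linarith

variable {P} in
-- The interface points are excluded because $\phi_\varepsilon=\frac12$ there for every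
-- $\varepsilon$.
lemma tendsto_φ {ε : ℕ → ℝ} (hε : ∀ k, 0 < ε k) (hlim : Tendsto ε atTop (𝓝 0)) {x : ℝ}
    (ha : x ≠ P.a₁) (hb : x ≠ P.b₁) : Tendsto (fun k => P.φ (ε k) x) atTop (𝓝 (P.χ x)) := by
  have hinv : Tendsto (fun k => (ε k)⁻¹) atTop atTop :=
    tendsto_inv_nhdsGT_zero.comp
      (tendsto_nhdsWithin_iff.2 ⟨hlim, Eventually.of_forall hε⟩)
  by_cases hx : x ∈ Ioo P.a₁ P.b₁
  · have hr : 0 < P.r x := by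
      rw [r_eq_min]; exact lt_min (by linarith [hx.1]) (by linarith [hx.2])
    have h := (((tendsto_tanh_atTop.comp (hinv.const_mul_atTop hr)).const_add 1).const_mul
      (1 / 2 : ℝ))
    rw [P.χ_of_mem hx]
    norm_num at h
    simpa [φ, div_eq_mul_inv, Function.comp_def] using h
  · have hr : P.r x < 0 := by
      rw [r_eq_min]
      rw [mem_Ioo, not_and_or, not_lt, not_lt] at hx
      rcases hx with h | h
      · exact min_lt_of_left_lt (by linarith [lt_of_le_of_ne h ha])
      · exact min_lt_of_right_lt (by linarith [lt_of_le_of_ne h hb.symm])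
    have h := (((tendsto_tanh_atBot.comp (hinv.const_mul_atTop_of_neg hr)).const_add 1).const_mul
      (1 / 2 : ℝ))
    rw [P.χ_of_notMem hx]
    norm_num at h
    simpa [φ, div_eq_mul_inv, Function.comp_def] using h

/-- `|φ_ε'|` acts as the sum of the Dirac masses at `a₁` and `b₁`, up to an error controlled by
`φ_ε - χ`. -/
lemma integral_abs_deriv_φ_mul {ε : ℝ} (hε : 0 < ε) {G g : ℝ → ℝ}
    (hG : IsPrimitiveOn P.a P.b G g) :
    IntervalIntegrable (fun x => |deriv (P.φ ε) x| * G x) volume P.a P.b ∧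
    IntervalIntegrable (fun x => (P.φ ε x - P.χ x) * (SignType.sign (x - P.mid) * g x))
      volume P.a P.b ∧
    ∫ x in P.a..P.b, |deriv (P.φ ε) x| * G x = G P.a₁ + G P.b₁
      + (∫ x in P.a..P.b, (P.φ ε x - P.χ x) * (SignType.sign (x - P.mid) * g x))
      + 2 * (P.φ ε P.mid - 1) * G P.mid - P.φ ε P.a * G P.a - P.φ ε P.b * G P.b := by
  have ha := P.a_lt
  have hm := P.a_lt_mid
  have hm' := P.mid_lt_b
  have hm1 := P.a₁_lt_mid
  have hm2 := P.mid_lt_b₁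
  have hb := P.b₁_lt
  have hGl := hG.mono le_rfl hm.le hm'.le
  have hGr := hG.mono hm.le hm'.le le_rfl
  have hφl := P.isPrimitiveOn_φ_left hε
  have hφr := P.isPrimitiveOn_φ_right hε
  have el := hφl.integral_mul_add_mul hGl hm.le
  have er := hφr.integral_mul_add_mul hGr hm'.le
  have il : IntervalIntegrable (fun x => |deriv (P.φ ε) x| * G x) volume P.a P.mid :=
    hφl.intervalIntegrable.mul_continuousOn (by
      rw [uIcc_of_le hm.le]; exact hGl.continuousOn hm.le)
  have ir : IntervalIntegrable (fun x => -|deriv (P.φ ε) x| * G x) volume P.mid P.b :=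
    hφr.intervalIntegrable.mul_continuousOn (by
      rw [uIcc_of_le hm'.le]; exact hGr.continuousOn hm'.le)
  have ir' : IntervalIntegrable (fun x => |deriv (P.φ ε) x| * G x) volume P.mid P.b := by
    have := ir.neg
    simpa [Pi.neg_def] using this
  have jl : IntervalIntegrable (fun x => P.φ ε x * g x) volume P.a P.mid :=
    hGl.intervalIntegrable.continuousOn_mul (P.continuous_φ ε).continuousOn
  have jr : IntervalIntegrable (fun x => P.φ ε x * g x) volume P.mid P.b :=
    hGr.intervalIntegrable.continuousOn_mul (P.continuous_φ ε).continuousOn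
  have kint : IntervalIntegrable (fun x => P.χ x * g x) volume P.a P.b := by
    rw [intervalIntegrable_iff] at *
    refine Integrable.bdd_mul (c := 1) hG.intervalIntegrable.def'
      P.measurable_χ.aestronglyMeasurable (ae_of_all _ fun x => ?_)
    by_cases hx : x ∈ Ioo P.a₁ P.b₁
    · simp [P.χ_of_mem hx]
    · simp [P.χ_of_notMem hx]
  have hsubl : uIcc P.a P.mid ⊆ uIcc P.a P.b := by
    rw [uIcc_of_le hm.le, uIcc_of_le P.a_lt_b.le]; exact Icc_subset_Icc_right hm'.le
  have hsubr : uIcc P.mid P.b ⊆ uIcc P.a P.b := by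
    rw [uIcc_of_le hm'.le, uIcc_of_le P.a_lt_b.le]; exact Icc_subset_Icc_left hm.le
  have kl := kint.mono_set hsubl
  have kr := kint.mono_set hsubr
  -- The value at $a_1$, i.e. the Dirac mass, arises here: integrating $g$ over $\Omega_1$ only
  -- leaves a difference of values of $G$.
  have hχl : ∫ x in P.a..P.mid, P.χ x * g x = G P.mid - G P.a₁ := by
    rw [← intervalIntegral.integral_add_adjacent_intervals (b := P.a₁)
      (kl.mono_set (by
        rw [uIcc_of_le hm.le, uIcc_of_le ha.le]; exact Icc_subset_Icc_right hm1.le))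
      (kl.mono_set (by
        rw [uIcc_of_le hm.le, uIcc_of_le hm1.le]; exact Icc_subset_Icc_left ha.le)),
      intervalIntegral.integral_zero_ae (μ := volume) (a := P.a), zero_add,
      hG.sub_eq ⟨ha.le, by linarith⟩ ⟨hm.le, hm'.le⟩]
    · apply intervalIntegral.integral_congr_ae
      refine ae_of_all _ fun x hx => ?_
      rw [uIoc_of_le hm1.le] at hx
      rw [P.χ_of_mem ⟨hx.1, hx.2.trans_lt hm2⟩, one_mul]
    · refine ae_of_all _ fun x hx => ?_
      rw [uIoc_of_le ha.le] at hx
      rw [P.χ_of_notMem fun h => absurd h.1 (not_lt.2 hx.2), zero_mul]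
  have hχr : ∫ x in P.mid..P.b, P.χ x * g x = G P.b₁ - G P.mid := by
    rw [← intervalIntegral.integral_add_adjacent_intervals (b := P.b₁)
      (kr.mono_set (by
        rw [uIcc_of_le hm'.le, uIcc_of_le hm2.le]; exact Icc_subset_Icc_right hb.le))
      (kr.mono_set (by
        rw [uIcc_of_le hm'.le, uIcc_of_le hb.le]; exact Icc_subset_Icc_left hm2.le)),
      intervalIntegral.integral_zero_ae (μ := volume) (a := P.b₁), add_zero,
      hG.sub_eq ⟨hm.le, hm'.le⟩ ⟨by linarith, hb.le⟩]
    · rw [intervalIntegral_eq_integral_Ioo hm2.le, intervalIntegral_eq_integral_Ioo hm2.le]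
      refine setIntegral_congr_fun measurableSet_Ioo fun x hx => ?_
      simp only [P.χ_of_mem ⟨hm1.trans hx.1, hx.2⟩, one_mul]
    · refine ae_of_all _ fun x hx => ?_
      rw [uIoc_of_le hb.le] at hx
      rw [P.χ_of_notMem fun h => absurd h.2 (not_lt.2 hx.1.le), zero_mul]
  have ml : IntervalIntegrable (fun x => (P.φ ε x - P.χ x) * (SignType.sign (x - P.mid) * g x))
      volume P.a P.mid := by
    refine (kl.sub jl).congr_ae ?_
    rw [uIoc_of_le hm.le, ← restrict_Ioo_eq_restrict_Ioc]
    filter_upwards [ae_restrict_mem measurableSet_Ioo] with x hx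
    rw [sign_neg (by linarith [hx.2] : x - P.mid < 0)]
    simp; ring
  have mr : IntervalIntegrable (fun x => (P.φ ε x - P.χ x) * (SignType.sign (x - P.mid) * g x))
      volume P.mid P.b := by
    refine (jr.sub kr).congr_ae ?_
    rw [uIoc_of_le hm'.le, ← restrict_Ioo_eq_restrict_Ioc]
    filter_upwards [ae_restrict_mem measurableSet_Ioo] with x hx
    rw [sign_pos (by linarith [hx.1] : 0 < x - P.mid)]
    simp; ring
  have vl : ∫ x in P.a..P.mid, (P.φ ε x - P.χ x) * (SignType.sign (x - P.mid) * g x) =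
      (∫ x in P.a..P.mid, P.χ x * g x) - ∫ x in P.a..P.mid, P.φ ε x * g x := by
    rw [← intervalIntegral.integral_sub kl jl, intervalIntegral_eq_integral_Ioo hm.le,
      intervalIntegral_eq_integral_Ioo hm.le]
    refine setIntegral_congr_fun measurableSet_Ioo fun x hx => ?_
    rw [sign_neg (by linarith [hx.2] : x - P.mid < 0)]
    simp; ring
  have vr : ∫ x in P.mid..P.b, (P.φ ε x - P.χ x) * (SignType.sign (x - P.mid) * g x) =
      (∫ x in P.mid..P.b, P.φ ε x * g x) - ∫ x in P.mid..P.b, P.χ x * g x := by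
    rw [← intervalIntegral.integral_sub jr kr, intervalIntegral_eq_integral_Ioo hm'.le,
      intervalIntegral_eq_integral_Ioo hm'.le]
    refine setIntegral_congr_fun measurableSet_Ioo fun x hx => ?_
    rw [sign_pos (by linarith [hx.1] : 0 < x - P.mid)]
    simp; ring
  -- Both halves contribute a boundary term at the midpoint, whence the factor $2$.
  refine ⟨il.trans ir', ml.trans mr, ?_⟩
  rw [intervalIntegral.integral_add il jl] at el
  rw [intervalIntegral.integral_add ir jr] at er
  have en : ∫ x in P.mid..P.b, -|deriv (P.φ ε) x| * G x =
      -∫ x in P.mid..P.b, |deriv (P.φ ε) x| * G x := by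
    rw [← intervalIntegral.integral_neg]; congr 1; ext x; ring
  rw [← intervalIntegral.integral_add_adjacent_intervals il ir',
    ← intervalIntegral.integral_add_adjacent_intervals ml mr, vl, vr, hχl, hχr]
  linarith

end Data

/-! ### $L^2$ estimates, differences in $H^1$ and the Sobolev inequality -/

section L2

variable {μ : Measure ℝ} {f g k : ℝ → ℝ}

lemma integrable_mul_of_memLp (hf : MemLp f 2 μ) (hg : MemLp g 2 μ) :
    Integrable (fun x => f x * g x) μ := hf.integrable_mul hg

lemma memLp_bounded_mul (hf : MemLp f 2 μ) {C : ℝ} (hk : AEStronglyMeasurable k μ)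
    (hC : ∀ᵐ x ∂μ, |k x| ≤ C) : MemLp (fun x => k x * f x) 2 μ := by
  refine hf.of_le_mul (c := C) (hk.mul hf.1) ?_
  filter_upwards [hC] with x hx
  rw [norm_mul]
  exact mul_le_mul_of_nonneg_right hx (norm_nonneg _)

/-- The Cauchy-Schwarz inequality in `L²`. -/
lemma abs_integral_mul_le (hf : MemLp f 2 μ) (hg : MemLp g 2 μ) :
    |∫ x, f x * g x ∂μ| ≤ √(∫ x, f x ^ 2 ∂μ) * √(∫ x, g x ^ 2 ∂μ) := by
  have hff := hf.integrable_sq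
  have hgg := hg.integrable_sq
  have hfg := integrable_mul_of_memLp hf hg
  -- A nonnegative quadratic in $t$ has nonpositive discriminant.
  have key : ∀ t : ℝ, 0 ≤ (∫ x, g x ^ 2 ∂μ) * (t * t) + (2 * ∫ x, f x * g x ∂μ) * t
      + ∫ x, f x ^ 2 ∂μ := by
    intro t
    have h : 0 ≤ ∫ x, (f x + t * g x) ^ 2 ∂μ := integral_nonneg fun x => sq_nonneg _
    have e : (fun x => (f x + t * g x) ^ 2) =
        fun x => (t * t) * g x ^ 2 + (2 * t) * (f x * g x) + f x ^ 2 := by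
      ext x; ring
    have hi : Integrable (fun x => (t * t) * g x ^ 2 + (2 * t) * (f x * g x)) μ :=
      (hgg.const_mul _).add (hfg.const_mul _)
    rw [e, integral_add hi hff, integral_add (hgg.const_mul _) (hfg.const_mul _), integral_const_mul,
      integral_const_mul] at h
    linarith
  have hd := discrim_le_zero key
  rw [discrim] at hd
  rw [← Real.sqrt_mul (integral_nonneg fun x => sq_nonneg _)]
  apply Real.abs_le_sqrt
  linarith

end L2

namespace H1

variable {U : Set ℝ}

/-- The difference of two elements of `H¹`. -/
def sub (hU : MeasurableSet U) (u v : H1 U) : H1 U where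
  toFun x := u x - v x
  grad x := u.grad x - v.grad x
  memLp := u.memLp.sub v.memLp
  memLp_grad := u.memLp_grad.sub v.memLp_grad
  hasWeakDeriv :=
    { locInt := u.hasWeakDeriv.locInt.sub v.hasWeakDeriv.locInt
      locInt_deriv := u.hasWeakDeriv.locInt_deriv.sub v.hasWeakDeriv.locInt_deriv
      integral_eq := fun ψ hψ hc hs => by
        have hψ' : Continuous (deriv ψ) := hψ.continuous_deriv (by simp)
        have hs' : tsupport (deriv ψ) ⊆ U := tsupport_deriv_subset.trans hs
        simp only [sub_mul]
        rw [integral_sub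
            (integrableOn_mul_testFunction hU u.hasWeakDeriv.locInt hψ' hc.deriv hs')
            (integrableOn_mul_testFunction hU v.hasWeakDeriv.locInt hψ' hc.deriv hs'),
          integral_sub
            (integrableOn_mul_testFunction hU u.hasWeakDeriv.locInt_deriv hψ.continuous hc hs)
            (integrableOn_mul_testFunction hU v.hasWeakDeriv.locInt_deriv hψ.continuous hc hs),
          u.hasWeakDeriv.integral_eq ψ hψ hc hs, v.hasWeakDeriv.integral_eq ψ hψ hc hs]
        ring }

lemma exists_isPrimitiveOn {a b : ℝ} (hab : a < b) (u : H1 (Ioo a b)) :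
    ∃ W, IsPrimitiveOn a b W u.grad ∧ W =ᵐ[volume.restrict (Ioo a b)] u :=
  u.hasWeakDeriv.exists_isPrimitiveOn hab (u.memLp_grad.integrable one_le_two)

end H1

/-- The Sobolev inequality for the sup norm on a bounded interval. -/
lemma IsPrimitiveOn.abs_le {a b : ℝ} (hab : a < b) {V v : ℝ → ℝ} (hV : IsPrimitiveOn a b V v)
    (hV2 : MemLp V 2 (volume.restrict (Ioo a b))) (hv2 : MemLp v 2 (volume.restrict (Ioo a b)))
    {x : ℝ} (hx : x ∈ Icc a b) :
    |V x| ≤ (√(b - a))⁻¹ * √(∫ y in Ioo a b, V y ^ 2) +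
      √(b - a) * √(∫ y in Ioo a b, v y ^ 2) := by
  have hl : 0 < b - a := sub_pos.2 hab
  have hone : MemLp (fun _ : ℝ => (1 : ℝ)) 2 (volume.restrict (Ioo a b)) := memLp_const 1
  have hvol : ∫ _ in Ioo a b, (1 : ℝ) ^ 2 = b - a := by simp [hab.le]
  have c1 : ∫ y in Ioo a b, |V y| ≤ √(b - a) * √(∫ y in Ioo a b, V y ^ 2) := by
    have h := abs_integral_mul_le hone hV2.abs
    simp only [one_mul, sq_abs, Pi.abs_apply] at h
    rw [hvol] at h
    exact (le_abs_self _).trans h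
  have c2 : ∫ y in Ioo a b, |v y| ≤ √(b - a) * √(∫ y in Ioo a b, v y ^ 2) := by
    have h := abs_integral_mul_le hone hv2.abs
    simp only [one_mul, sq_abs, Pi.abs_apply] at h
    rw [hvol] at h
    exact (le_abs_self _).trans h
  have hVi : Integrable (fun y => |V y|) (volume.restrict (Ioo a b)) :=
    (hV2.integrable one_le_two).abs
  have hvi : Integrable (fun y => |v y|) (volume.restrict (Ioo a b)) :=
    (hv2.integrable one_le_two).abs
  -- Compare with the value at an arbitrary $y$, then average over $y$ and apply Cauchy-Schwarz to
  -- both integrals.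
  have hpt : ∀ y ∈ Ioo a b, |V x| ≤ |V y| + ∫ t in Ioo a b, |v t| := by
    intro y hy
    have hy' := Ioo_subset_Icc_self hy
    have h1 := hV.sub_eq hy' hx
    have h2 : |V x - V y| ≤ ∫ t in Ioo a b, |v t| := by
      rw [h1]
      refine (intervalIntegral.norm_integral_le_integral_norm_uIoc (f := v) (μ := volume)).trans ?_
      rw [← integral_Ioc_eq_integral_Ioo]
      refine setIntegral_mono_set ?_ (ae_of_all _ fun t => abs_nonneg _)
        (LE.le.eventuallyLE ?_)
      · rwa [IntegrableOn, ← restrict_Ioo_eq_restrict_Ioc]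
      · exact Ioc_subset_Ioc (le_min hy'.1 hx.1) (max_le hy'.2 hx.2)
    have h3 := abs_sub_abs_le_abs_sub (V x) (V y)
    linarith
  have h_mean : (b - a) * |V x| ≤ (∫ y in Ioo a b, |V y|) + (b - a) * ∫ t in Ioo a b, |v t| := by
    have h := setIntegral_mono_on (μ := volume) (integrable_const (|V x|))
      (hVi.add (integrable_const (∫ t in Ioo a b, |v t|))) measurableSet_Ioo hpt
    simp only [Pi.add_apply] at h
    rw [integral_add hVi (integrable_const _)] at h
    simpa [hab.le] using h
  have hs : √(b - a) * √(b - a) = b - a := Real.mul_self_sqrt hl.le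
  have hsp : 0 < √(b - a) := Real.sqrt_pos.2 hl
  refine le_of_mul_le_mul_left (h_mean.trans ?_) hl
  have e : (b - a) * ((√(b - a))⁻¹ * √(∫ y in Ioo a b, V y ^ 2) +
      √(b - a) * √(∫ y in Ioo a b, v y ^ 2)) =
      √(b - a) * √(∫ y in Ioo a b, V y ^ 2) +
      (b - a) * (√(b - a) * √(∫ y in Ioo a b, v y ^ 2)) := by
    rw [mul_add, ← mul_assoc]
    congr 2
    nth_rewrite 1 [← hs]
    field_simp
  rw [e]
  exact add_le_add c1 (mul_le_mul_of_nonneg_left c2 hl.le)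

/-! ### Weak form of the two-sided problem -/

/-- Integration by parts of a second-order equation on an interval. -/
lemma integral_flux_eq {U : Set ℝ} (hU : MeasurableSet U) {c d δ : ℝ} (hcd : c < d)
    (hsub : Ioo c d ⊆ U) (hδ : δ ≠ 0) {z z' p R V v E : ℝ → ℝ} (hp : IsContRep U z p)
    (hz : HasWeakDeriv U z z') (hR : IntegrableOn R (Ioo c d))
    (heq : ∀ᵐ x ∂volume.restrict U, δ * z' x = R x) (hV : IsPrimitiveOn c d V v)
    (hE : ∀ᵐ x ∂volume.restrict (Ioo c d), R x * V x + δ * z x * v x = E x) :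
    IntervalIntegrable E volume c d ∧
      ∫ x in c..d, E x = δ * p d * V d - δ * p c * V c := by
  have heq' := ae_restrict_of_ae_restrict_of_subset hsub heq
  have hp' := ae_restrict_of_ae_restrict_of_subset hsub hp.2
  have hz'R : z' =ᵐ[volume.restrict (Ioo c d)] fun x => δ⁻¹ * R x := by
    filter_upwards [heq'] with x hx
    rw [← hx, inv_mul_cancel_left₀ hδ]
  have hz'i : IntegrableOn z' (Ioo c d) := (hR.const_mul δ⁻¹).congr hz'R.symm
  -- Almost everywhere $(\delta pV)'=\delta z'V+\delta pv=RV+\delta zv=E$. Leaving $E$ free lets one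
  -- integrand written with $\chi$ serve on all three intervals.
  have hprim := (((hp.isPrimitiveOn hU hcd hsub hz hz'i).mul hV hcd.le).const_mul δ).congr_ae
    hcd.le (g := E) (by
      filter_upwards [heq', hp', hE] with x h1 h2 h3
      rw [← h3, ← h1, h2]
      ring)
  refine ⟨hprim.intervalIntegrable, ?_⟩
  rw [← hprim.sub_eq (left_mem_Icc.2 hcd.le) (right_mem_Icc.2 hcd.le)]
  ring

namespace Data

variable {P : Data}

/-- The weak formulation of the two-sided problem. -/
lemma IsTwoSidedSolution.weak_form {u : H1 P.Ω} (hu : P.IsTwoSidedSolution u) :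
    ∃ w gc, IsContRep P.Ω u w ∧ IsContRep P.Ω P.g gc ∧ ∀ V v, IsPrimitiveOn P.a P.b V v →
      IntervalIntegrable (fun x => (P.α + (1 - P.α) * P.χ x) * u.grad x * v x
        + (P.β + (P.γ - P.β) * P.χ x) * u x * V x
        - (P.h x + (P.q x - P.h x) * P.χ x) * V x) volume P.a P.b ∧
      ∫ x in P.a..P.b, ((P.α + (1 - P.α) * P.χ x) * u.grad x * v x
        + (P.β + (P.γ - P.β) * P.χ x) * u x * V x
        - (P.h x + (P.q x - P.h x) * P.χ x) * V x) =
        - (P.κ * w P.a₁ + gc P.a₁) * V P.a₁ - (P.κ * w P.b₁ + gc P.b₁) * V P.b₁ := by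
  obtain ⟨⟨z₁, hz₁, he₁⟩, ⟨z₂, hz₂, he₂⟩, w, gc, p₁, p₂, hw, hgc, hp₁, hp₂, ha₁, hb₁, ha, hb⟩ := hu
  refine ⟨w, gc, hw, hgc, fun V v hV => ?_⟩
  have l1 := P.a_lt
  have l2 := P.a₁_lt
  have l3 := P.b₁_lt
  have hui : IntegrableOn u (Ioo P.a P.b) :=
    MemLp.integrable (μ := volume.restrict (Ioo P.a P.b)) one_le_two u.memLp
  have hqi : IntegrableOn P.q (Ioo P.a P.b) := P.q_memLp.integrable one_le_two
  have hhi : IntegrableOn P.h (Ioo P.a P.b) := P.h_memLp.integrable one_le_two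
  have hR1 : IntegrableOn (fun x => P.γ * u x - P.q x) (Ioo P.a P.b) := (hui.const_mul _).sub hqi
  have hR2 : IntegrableOn (fun x => P.β * u x - P.h x) (Ioo P.a P.b) := (hui.const_mul _).sub hhi
  have hmU : MeasurableSet P.Ω₂ := measurableSet_Ioo.union measurableSet_Ioo
  have he₂' : ∀ᵐ x ∂volume.restrict P.Ω₂, P.α * z₂ x = P.β * u x - P.h x := by
    filter_upwards [he₂] with x hx using by linarith
  have he₁' : ∀ᵐ x ∂volume.restrict P.Ω₁, 1 * z₁ x = P.γ * u x - P.q x := by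
    filter_upwards [he₁] with x hx using by linarith
  obtain ⟨i1, e1⟩ := integral_flux_eq hmU l1 subset_union_left P.α_pos.ne' hp₂ hz₂
    (hR2.mono_set (Ioo_subset_Ioo_right (by linarith))) he₂' (hV.mono le_rfl l1.le (by linarith))
    (E := fun x => (P.α + (1 - P.α) * P.χ x) * u.grad x * v x
        + (P.β + (P.γ - P.β) * P.χ x) * u x * V x
        - (P.h x + (P.q x - P.h x) * P.χ x) * V x) (by
      filter_upwards [ae_restrict_mem measurableSet_Ioo] with x hx
      rw [P.χ_of_notMem fun h => by linarith [h.1, hx.2]]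
      ring)
  obtain ⟨i2, e2⟩ := integral_flux_eq measurableSet_Ioo l2 Subset.rfl one_ne_zero hp₁ hz₁
    (hR1.mono_set (Ioo_subset_Ioo l1.le l3.le)) he₁' (hV.mono l1.le l2.le l3.le)
    (E := fun x => (P.α + (1 - P.α) * P.χ x) * u.grad x * v x
        + (P.β + (P.γ - P.β) * P.χ x) * u x * V x
        - (P.h x + (P.q x - P.h x) * P.χ x) * V x) (by
      filter_upwards [ae_restrict_mem measurableSet_Ioo] with x hx
      rw [P.χ_of_mem hx]
      ring)
  obtain ⟨i3, e3⟩ := integral_flux_eq hmU l3 subset_union_right P.α_pos.ne' hp₂ hz₂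
    (hR2.mono_set (Ioo_subset_Ioo_left (by linarith))) he₂' (hV.mono (by linarith) l3.le le_rfl)
    (E := fun x => (P.α + (1 - P.α) * P.χ x) * u.grad x * v x
        + (P.β + (P.γ - P.β) * P.χ x) * u x * V x
        - (P.h x + (P.q x - P.h x) * P.χ x) * V x) (by
      filter_upwards [ae_restrict_mem measurableSet_Ioo] with x hx
      rw [P.χ_of_notMem fun h => by linarith [h.2, hx.1]]
      ring)
  refine ⟨(i1.trans i2).trans i3, ?_⟩
  -- In the sum the fluxes at $a_1$ and $b_1$ combine into the jumps prescribed by the Robin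
  -- condition; those at $a$ and $b$ vanish.
  rw [← intervalIntegral.integral_add_adjacent_intervals (i1.trans i2) i3,
    ← intervalIntegral.integral_add_adjacent_intervals i1 i2, e1, e2, e3, ← ha₁, ← hb₁]
  have ha' : P.α * p₂ P.a = 0 := by linarith
  have hb' : P.α * p₂ P.b = 0 := by linarith
  rw [ha', hb']
  ring

instance : IsFiniteMeasure (volume.restrict P.Ω) :=
  inferInstanceAs (IsFiniteMeasure (volume.restrict (Ioo P.a P.b)))

lemma intervalIntegrable_iff_integrableOn_Ω {f : ℝ → ℝ} :
    IntervalIntegrable f volume P.a P.b ↔ IntegrableOn f P.Ω :=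
  intervalIntegrable_iff_integrableOn_Ioo_of_le P.a_lt_b.le

lemma intervalIntegral_eq_integral_Ω (f : ℝ → ℝ) :
    ∫ x in P.a..P.b, f x = ∫ x in P.Ω, f x :=
  intervalIntegral_eq_integral_Ioo P.a_lt_b.le f

/-! ### Integrability of the diffuse form at fixed $\varepsilon$ -/

section Integrability

variable {k : ℝ → ℝ} {ε : ℝ}

lemma memLp_affine_φ_mul (s t : ℝ) (hk : MemLp k 2 (volume.restrict P.Ω)) :
    MemLp (fun x => (s + t * P.φ ε x) * k x) 2 (volume.restrict P.Ω) := by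
  refine memLp_bounded_mul hk (C := |s| + |t|)
    (continuous_const.add (continuous_const.mul (P.continuous_φ ε))).aestronglyMeasurable
    (ae_of_all _ fun x => (abs_add_le _ _).trans ?_)
  rw [abs_mul, abs_of_pos (P.φ_pos ε x)]
  have := mul_le_mul_of_nonneg_left (P.φ_lt_one ε x).le (abs_nonneg t)
  linarith

lemma memLp_abs_deriv_φ_mul (hε : 0 < ε) (hk : MemLp k 2 (volume.restrict P.Ω)) :
    MemLp (fun x => |deriv (P.φ ε) x| * k x) 2 (volume.restrict P.Ω) := by
  refine memLp_bounded_mul hk (C := 1 / ε) (measurable_deriv _).abs.aestronglyMeasurable ?_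
  filter_upwards [ae_restrict_of_ae (P.ae_abs_deriv_φ_le hε)] with x hx
  rwa [abs_abs]

lemma memLp_φ_sub_χ_mul (ε : ℝ) (hk : MemLp k 2 (volume.restrict P.Ω)) :
    MemLp (fun x => (P.φ ε x - P.χ x) * k x) 2 (volume.restrict P.Ω) :=
  memLp_bounded_mul hk (C := 1)
    ((P.continuous_φ ε).measurable.sub P.measurable_χ).aestronglyMeasurable
    (ae_of_all _ fun x => P.abs_φ_sub_χ_le ε x)

lemma memLp_sign_mul (m : ℝ) (hk : MemLp k 2 (volume.restrict P.Ω)) :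
    MemLp (fun x => (SignType.sign (x - m) : ℝ) * k x) 2 (volume.restrict P.Ω) := by
  have hs : (fun x : ℝ => (SignType.sign (x - m) : ℝ)) =
      fun x => if 0 < x - m then 1 else if x - m < 0 then -1 else 0 := by
    ext x
    rw [sign_apply]
    split_ifs <;> simp
  refine memLp_bounded_mul hk (C := 1) ?_ (ae_of_all _ fun x => ?_)
  · rw [hs]
    exact (Measurable.ite (measurableSet_lt measurable_const (measurable_id.sub_const m))
      measurable_const (Measurable.ite (measurableSet_lt (measurable_id.sub_const m)
        measurable_const) measurable_const measurable_const)).aestronglyMeasurable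
  · rw [congrFun hs x]
    split_ifs <;> simp

lemma integrable_diffuse_form (hε : 0 < ε) (u v : H1 P.Ω) :
    Integrable (fun x => P.D ε x * u.grad x * v.grad x + P.c ε x * u x * v x
        + (P.κ * u x + P.g x) * |deriv (P.φ ε) x| * v x) (volume.restrict P.Ω) := by
  have h1 := integrable_mul_of_memLp (memLp_affine_φ_mul (ε := ε) P.α (1 - P.α) u.memLp_grad)
    v.memLp_grad
  have h2 := integrable_mul_of_memLp (memLp_affine_φ_mul (ε := ε) P.β (P.γ - P.β) u.memLp) v.memLp
  have hg : MemLp (fun x => P.κ * u x + P.g x) 2 (volume.restrict P.Ω) :=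
    (u.memLp.const_mul P.κ).add P.g.memLp
  have h3 := integrable_mul_of_memLp (memLp_abs_deriv_φ_mul hε hg) v.memLp
  refine ((h1.add h2).add h3).congr (ae_of_all _ fun x => ?_)
  simp only [Pi.add_apply, D, c]
  ring

lemma integrable_source_mul (ε : ℝ) (v : H1 P.Ω) :
    Integrable (fun x => P.f ε x * v x) (volume.restrict P.Ω) := by
  have hh : MemLp P.h 2 (volume.restrict P.Ω) := P.h_memLp
  have hq : MemLp P.q 2 (volume.restrict P.Ω) := P.q_memLp
  have h1 := memLp_affine_φ_mul (ε := ε) 0 1 (hq.sub hh)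
  refine (integrable_mul_of_memLp (hh.add h1) v.memLp).congr (ae_of_all _ fun x => ?_)
  simp only [Pi.add_apply, Pi.sub_apply, f]
  ring

end Integrability

/-! ### The residual of $u_0$ in the diffuse problem -/

/-- The residual of the sharp-interface solution in the diffuse domain problem. -/
lemma IsTwoSidedSolution.exists_residual_eq {u : H1 P.Ω} (hu : P.IsTwoSidedSolution u) :
    ∃ (A B : ℝ → ℝ) (s m t : ℝ), MemLp A 2 (volume.restrict P.Ω) ∧
      MemLp B 2 (volume.restrict P.Ω) ∧
      ∀ ε, 0 < ε → ∀ (v : H1 P.Ω) (V : ℝ → ℝ), IsPrimitiveOn P.a P.b V v.grad →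
        V =ᵐ[volume.restrict P.Ω] v →
        (∫ x in P.Ω, (P.D ε x * u.grad x * v.grad x + P.c ε x * u x * v x
          + (P.κ * u x + P.g x) * |deriv (P.φ ε) x| * v x)) - ∫ x in P.Ω, P.f ε x * v x =
        (∫ x in P.Ω, (P.φ ε x - P.χ x) * A x * v.grad x)
          + (∫ x in P.Ω, (P.φ ε x - P.χ x) * B x * v x)
          + (P.φ ε P.mid - 1) * (m * V P.mid) - P.φ ε P.a * (s * V P.a)
          - P.φ ε P.b * (t * V P.b) := by
  obtain ⟨w, gc, hw, hgc, hweak⟩ := hu.weak_form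
  have hΩ : MeasurableSet P.Ω := measurableSet_Ioo
  set F : ℝ → ℝ := fun x => P.κ * w x + gc x with hFdef
  have hF : IsPrimitiveOn P.a P.b F (fun x => P.κ * u.grad x + P.g.grad x) := by
    exact ((hw.isPrimitiveOn hΩ P.a_lt_b Subset.rfl u.hasWeakDeriv
      (u.memLp_grad.integrable one_le_two)).const_mul P.κ).add
      (hgc.isPrimitiveOn hΩ P.a_lt_b Subset.rfl P.g.hasWeakDeriv
      (P.g.memLp_grad.integrable one_le_two))
  have hF2 : MemLp F 2 (volume.restrict P.Ω) := by
    refine ((u.memLp.const_mul P.κ).add P.g.memLp).ae_eq ?_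
    filter_upwards [hw.2, hgc.2] with x h1 h2
    simp only [hFdef, Pi.add_apply, h1, h2]
  have hF'2 : MemLp (fun x => P.κ * u.grad x + P.g.grad x) 2 (volume.restrict P.Ω) :=
    (u.memLp_grad.const_mul P.κ).add P.g.memLp_grad
  have hh : MemLp P.h 2 (volume.restrict P.Ω) := P.h_memLp
  have hq : MemLp P.q 2 (volume.restrict P.Ω) := P.q_memLp
  -- With $F=\kappa u_0+g$ one has $(FV)'=FV'+F'V$. The factor of $v'$ joins the coefficient error
  -- in $A$, that of $v$ the errors in $c_\varepsilon$ and $f_\varepsilon$ in $B$; the sign comes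
  -- from `integral_abs_deriv_φ_mul`.
  have hA : MemLp (fun x => (1 - P.α) * u.grad x + SignType.sign (x - P.mid) * F x) 2
      (volume.restrict P.Ω) := (u.memLp_grad.const_mul _).add (memLp_sign_mul _ hF2)
  have hB : MemLp (fun x => (P.γ - P.β) * u x - (P.q x - P.h x)
      + SignType.sign (x - P.mid) * (P.κ * u.grad x + P.g.grad x)) 2
      (volume.restrict P.Ω) :=
    ((u.memLp.const_mul _).sub (hq.sub hh)).add (memLp_sign_mul _ hF'2)
  refine ⟨_, _, F P.a, 2 * F P.mid, F P.b, hA, hB, fun ε hε v V hV hVv => ?_⟩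
  obtain ⟨j1, j2, j3⟩ := P.integral_abs_deriv_φ_mul hε (hF.mul hV P.a_lt_b.le)
  obtain ⟨i1, e1⟩ := hweak V v.grad hV
  have i2 := integrable_mul_of_memLp (memLp_φ_sub_χ_mul ε hA) v.memLp_grad
  have i3 := integrable_mul_of_memLp (memLp_φ_sub_χ_mul ε hB) v.memLp
  rw [intervalIntegrable_iff_integrableOn_Ω] at i1 j1 j2
  rw [intervalIntegral_eq_integral_Ω] at e1
  rw [intervalIntegral_eq_integral_Ω, intervalIntegral_eq_integral_Ω] at j3
  rw [← integral_sub (integrable_diffuse_form hε u v) (integrable_source_mul ε v)]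
  -- After substitution of `e1` and `j3`, the point values at $a_1,b_1$ cancel, and so does the
  -- integral belonging to `j2`.
  have hsplit := integral_add (i1.add ((i2.add i3).sub j2)) j1
  rw [integral_add' i1 ((i2.add i3).sub j2), integral_sub' (i2.add i3) j2, integral_add' i2 i3,
    j3, e1] at hsplit
  refine Eq.trans (integral_congr_ae ?_) (hsplit.trans ?_)
  · filter_upwards [hVv, hw.2, hgc.2] with x h1 h2 h3
    simp only [Pi.add_apply, Pi.sub_apply, hFdef, D, c, f, h1, h2, h3]
    ring
  · simp only [hFdef]
    ring

/-- Dominated convergence with majorant $A^2$, as $|\phi_\varepsilon-\chi|\le1$ uniformly in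
$\varepsilon$. -/
lemma tendsto_integral_φ_sub_χ_mul_sq {A : ℝ → ℝ} (hA : MemLp A 2 (volume.restrict P.Ω))
    {ε : ℕ → ℝ} (hε : ∀ k, 0 < ε k) (hlim : Tendsto ε atTop (𝓝 0)) :
    Tendsto (fun k => ∫ x in P.Ω, ((P.φ (ε k) x - P.χ x) * A x) ^ 2) atTop (𝓝 0) := by
  have h := tendsto_integral_of_dominated_convergence (μ := volume.restrict P.Ω)
    (F := fun k x => ((P.φ (ε k) x - P.χ x) * A x) ^ 2) (f := fun _ => 0) (fun x => A x ^ 2)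
    (fun k => (memLp_φ_sub_χ_mul (ε k) hA).integrable_sq.1) hA.integrable_sq
    (fun k => ae_of_all _ fun x => ?_) ?_
  · simpa using h
  · rw [Real.norm_of_nonneg (sq_nonneg _), mul_pow]
    have h1 := (sq_le_one_iff_abs_le_one _).2 (P.abs_φ_sub_χ_le (ε k) x)
    exact mul_le_of_le_one_left (sq_nonneg _) h1
  · have hne : ∀ c : ℝ, ∀ᵐ x : ℝ, x ≠ c := fun c => by simp [ae_iff, measure_singleton]
    filter_upwards [ae_restrict_of_ae (hne P.a₁), ae_restrict_of_ae (hne P.b₁)] with x h1 h2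
    have h3 := ((((tendsto_φ hε hlim h1 h2).sub_const (P.χ x)).mul_const (A x)).pow 2)
    simpa using h3

/-- The residual of the sharp-interface solution tends to zero in the dual of `H¹`. -/
lemma IsTwoSidedSolution.exists_residual_le {u : H1 P.Ω} (hu : P.IsTwoSidedSolution u)
    {ε : ℕ → ℝ} (hε : ∀ k, 0 < ε k) (hlim : Tendsto ε atTop (𝓝 0)) :
    ∃ δ : ℕ → ℝ, Tendsto δ atTop (𝓝 0) ∧ ∀ k (v : H1 P.Ω),
      |(∫ x in P.Ω, (P.D (ε k) x * u.grad x * v.grad x + P.c (ε k) x * u x * v x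
          + (P.κ * u x + P.g x) * |deriv (P.φ (ε k)) x| * v x)) - ∫ x in P.Ω, P.f (ε k) x * v x| ≤
        δ k * √((∫ x in P.Ω, v x ^ 2) + ∫ x in P.Ω, v.grad x ^ 2) := by
  obtain ⟨A, B, s, m, t, hA, hB, hres⟩ := hu.exists_residual_eq
  -- Sum of the two Sobolev constants of `IsPrimitiveOn.abs_le`, so that $|V|\le SN$ with
  -- $N=\|v\|_{H^1}$.
  set S : ℝ := (√(P.b - P.a))⁻¹ + √(P.b - P.a)
  have hS : 0 ≤ S := by positivity
  refine ⟨fun k => √(∫ x in P.Ω, ((P.φ (ε k) x - P.χ x) * A x) ^ 2)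
    + √(∫ x in P.Ω, ((P.φ (ε k) x - P.χ x) * B x) ^ 2)
    + (|P.φ (ε k) P.mid - 1| * (|m| * S) + |P.φ (ε k) P.a| * (|s| * S)
      + |P.φ (ε k) P.b| * (|t| * S)), ?_, fun k v => ?_⟩
  · have ta := (tendsto_integral_φ_sub_χ_mul_sq hA hε hlim).sqrt
    have tb := (tendsto_integral_φ_sub_χ_mul_sq hB hε hlim).sqrt
    have h1 := tendsto_φ hε hlim P.a₁_lt_mid.ne' P.mid_lt_b₁.ne
    have h2 := tendsto_φ hε hlim P.a_lt.ne (P.a_lt.trans P.a₁_lt).ne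
    have h3 := tendsto_φ hε hlim (P.a₁_lt.trans P.b₁_lt).ne' P.b₁_lt.ne'
    rw [P.χ_of_mem ⟨P.a₁_lt_mid, P.mid_lt_b₁⟩] at h1
    rw [P.χ_of_notMem fun h => lt_asymm h.1 P.a_lt] at h2
    rw [P.χ_of_notMem fun h => lt_asymm h.2 P.b₁_lt] at h3
    have h := (ta.add tb).add ((((h1.sub_const 1).abs.mul_const (|m| * S)).add
      (h2.abs.mul_const (|s| * S))).add (h3.abs.mul_const (|t| * S)))
    simpa using h
  · obtain ⟨V, hV, hVv⟩ := H1.exists_isPrimitiveOn P.a_lt_b v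
    rw [hres (ε k) (hε k) v V hV hVv]
    set N := √((∫ x in P.Ω, v x ^ 2) + ∫ x in P.Ω, v.grad x ^ 2)
    have n0 : 0 ≤ ∫ x in P.Ω, v x ^ 2 := integral_nonneg fun x => sq_nonneg _
    have n0' : 0 ≤ ∫ x in P.Ω, v.grad x ^ 2 := integral_nonneg fun x => sq_nonneg _
    have n1 : √(∫ x in P.Ω, v x ^ 2) ≤ N := Real.sqrt_le_sqrt (by linarith)
    have n2 : √(∫ x in P.Ω, v.grad x ^ 2) ≤ N := Real.sqrt_le_sqrt (by linarith)
    have hV2 : MemLp V 2 (volume.restrict P.Ω) := v.memLp.ae_eq hVv.symm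
    have hsup : ∀ x ∈ Icc P.a P.b, |V x| ≤ S * N := by
      intro x hx
      have h := hV.abs_le P.a_lt_b hV2 v.memLp_grad hx
      have e : ∫ y in Ioo P.a P.b, V y ^ 2 = ∫ x in P.Ω, v x ^ 2 := by
        refine integral_congr_ae ?_
        filter_upwards [hVv] with y hy
        rw [hy]
      rw [e] at h
      refine h.trans ?_
      rw [add_mul]
      exact add_le_add (mul_le_mul_of_nonneg_left n1 (by positivity))
        (mul_le_mul_of_nonneg_left n2 (by positivity))
    have c1 := (abs_integral_mul_le (memLp_φ_sub_χ_mul (ε k) hA) v.memLp_grad).trans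
      (mul_le_mul_of_nonneg_left n2 (Real.sqrt_nonneg _))
    have c2 := (abs_integral_mul_le (memLp_φ_sub_χ_mul (ε k) hB) v.memLp).trans
      (mul_le_mul_of_nonneg_left n1 (Real.sqrt_nonneg _))
    have hpt : ∀ y r x, x ∈ Icc P.a P.b → |y * (r * V x)| ≤ |y| * (|r| * S) * N := by
      intro y r x hx
      rw [abs_mul, abs_mul, mul_assoc, mul_assoc]
      exact mul_le_mul_of_nonneg_left (mul_le_mul_of_nonneg_left (hsup x hx) (abs_nonneg _))
        (abs_nonneg _)
    have c3 := hpt (P.φ (ε k) P.mid - 1) m P.mid ⟨P.a_lt_mid.le, P.mid_lt_b.le⟩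
    have c4 := hpt (P.φ (ε k) P.a) s P.a ⟨le_rfl, P.a_lt_b.le⟩
    have c5 := hpt (P.φ (ε k) P.b) t P.b ⟨P.a_lt_b.le, le_rfl⟩
    refine ((abs_sub _ _).trans (add_le_add ((abs_sub _ _).trans (add_le_add
      ((abs_add_le _ _).trans (add_le_add ((abs_add_le _ _).trans (add_le_add c1 c2)) c3))
      c4)) c5)).trans (le_of_eq ?_)
    ring

/-! ### Coercivity and convergence -/

variable (P) in
/-- A lower bound for the coefficients `D_ε` and `c_ε`. -/
noncomputable def ellipticity : ℝ := min (min P.α 1) (min P.β P.γ)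

lemma ellipticity_pos : 0 < P.ellipticity :=
  lt_min (lt_min P.α_pos one_pos) (lt_min P.β_pos P.γ_pos)

/-- $D_\varepsilon$ is a convex combination of $\alpha$ and $1$. -/
lemma ellipticity_le_D (ε x : ℝ) : P.ellipticity ≤ P.D ε x := by
  have h1 := P.φ_pos ε x
  have h2 := P.φ_lt_one ε x
  have h3 : P.ellipticity ≤ P.α := (min_le_left _ _).trans (min_le_left _ _)
  have h4 : P.ellipticity ≤ 1 := (min_le_left _ _).trans (min_le_right _ _)
  unfold D
  nlinarith

lemma ellipticity_le_c (ε x : ℝ) : P.ellipticity ≤ P.c ε x := by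
  have h1 := P.φ_pos ε x
  have h2 := P.φ_lt_one ε x
  have h3 : P.ellipticity ≤ P.β := (min_le_right _ _).trans (min_le_left _ _)
  have h4 : P.ellipticity ≤ P.γ := (min_le_right _ _).trans (min_le_right _ _)
  unfold c
  nlinarith

/-- Coercivity of the diffuse problem: the error is bounded by its residual. -/
lemma IsDiffuseSolution.ellipticity_mul_le {ε : ℝ} (hε : 0 < ε) {u : H1 P.Ω}
    (hu : P.IsDiffuseSolution ε u) (u₀ : H1 P.Ω) (hΩ : MeasurableSet P.Ω) :
    P.ellipticity * ((∫ x in P.Ω, u.sub hΩ u₀ x ^ 2) + ∫ x in P.Ω, (u.sub hΩ u₀).grad x ^ 2) ≤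
      |(∫ x in P.Ω, (P.D ε x * u₀.grad x * (u.sub hΩ u₀).grad x + P.c ε x * u₀ x * u.sub hΩ u₀ x
        + (P.κ * u₀ x + P.g x) * |deriv (P.φ ε) x| * u.sub hΩ u₀ x))
        - ∫ x in P.Ω, P.f ε x * u.sub hΩ u₀ x| := by
  have h := hu (u.sub hΩ u₀)
  have i1 := integrable_diffuse_form hε u (u.sub hΩ u₀)
  have i2 := integrable_diffuse_form hε u₀ (u.sub hΩ u₀)
  -- The equation for $u$ replaces the source term. In the difference of the two forms $g$ cancels,
  -- leaving $D_\varepsilon e'^2+c_\varepsilon e^2+\kappa|\phi_\varepsilon'|e^2$ with $e=u-u_0$; the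
  -- last term is dropped.
  rw [← h, abs_sub_comm, ← integral_sub i1 i2]
  refine le_trans ?_ (le_abs_self _)
  have j1 := (u.sub hΩ u₀).memLp.integrable_sq
  have j2 := (u.sub hΩ u₀).memLp_grad.integrable_sq
  rw [← integral_add j1 j2, ← integral_const_mul]
  refine integral_mono ((j1.add j2).const_mul _) (i1.sub i2) fun x => ?_
  have h1 := mul_le_mul_of_nonneg_right (ellipticity_le_D (P := P) ε x)
    (sq_nonneg (u.grad x - u₀.grad x))
  have h2 := mul_le_mul_of_nonneg_right (ellipticity_le_c (P := P) ε x)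
    (sq_nonneg (u x - u₀ x))
  have h3 : 0 ≤ P.κ * |deriv (P.φ ε) x| * (u x - u₀ x) ^ 2 :=
    mul_nonneg (mul_nonneg P.κ_nonneg (abs_nonneg _)) (sq_nonneg _)
  simp only [H1.sub]
  linarith

/-- The solutions of the diffuse domain problem converge to the solution of the two-sided
problem in `H¹`. -/
theorem tendsto_dist_of_isDiffuseSolution {u₀ : H1 P.Ω} (hu₀ : P.IsTwoSidedSolution u₀)
    {ε : ℕ → ℝ} (hε : ∀ k, 0 < ε k) (hlim : Tendsto ε atTop (𝓝 0))
    {u : ℕ → H1 P.Ω} (hu : ∀ k, P.IsDiffuseSolution (ε k) (u k)) :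
    Tendsto (fun k => H1.dist (u k) u₀) atTop (𝓝 0) := by
  obtain ⟨δ, hδ, hres⟩ := hu₀.exists_residual_le hε hlim
  have hΩ : MeasurableSet P.Ω := measurableSet_Ioo
  refine squeeze_zero (g := fun k => |δ k| / P.ellipticity) (fun k => Real.sqrt_nonneg _)
    (fun k => ?_) (by simpa using hδ.abs.div_const P.ellipticity)
  have h1 := ((hu k).ellipticity_mul_le (hε k) u₀ hΩ).trans (hres k ((u k).sub hΩ u₀))
  change P.ellipticity * ((∫ x in P.Ω, (u k x - u₀ x) ^ 2)
    + ∫ x in P.Ω, ((u k).grad x - u₀.grad x) ^ 2) ≤ δ k * H1.dist (u k) u₀ at h1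
  have hsq : (∫ x in P.Ω, (u k x - u₀ x) ^ 2) + ∫ x in P.Ω, ((u k).grad x - u₀.grad x) ^ 2 =
      H1.dist (u k) u₀ * H1.dist (u k) u₀ :=
    (Real.mul_self_sqrt (add_nonneg (integral_nonneg fun x => sq_nonneg _)
      (integral_nonneg fun x => sq_nonneg _))).symm
  rw [hsq, ← mul_assoc] at h1
  have hp := ellipticity_pos (P := P)
  have hd : 0 ≤ H1.dist (u k) u₀ := Real.sqrt_nonneg _
  -- One factor of the distance is cancelled, which requires it to be nonzero.
  rcases hd.eq_or_lt with h0 | h0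
  · rw [← h0]; positivity
  · rw [le_div_iff₀ hp, mul_comm]
    exact (le_of_mul_le_mul_right h1 h0).trans (le_abs_self _)

end Data

end DiffuseDomain

theorem mainTheorem4 (P : DiffuseDomain.Data)
    (u₀ : DiffuseDomain.H1 P.Ω) (hu₀ : P.IsTwoSidedSolution u₀)
    (ε : ℕ → ℝ) (hε : ∀ k, ε k ∈ Set.Ioo (0 : ℝ) 1)
    (hε_lim : Filter.Tendsto ε Filter.atTop (nhds 0))
    (u : ℕ → DiffuseDomain.H1 P.Ω) (hu : ∀ k, P.IsDiffuseSolution (ε k) (u k)) :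
    ∃ σ : ℕ → ℕ, StrictMono σ ∧
      Filter.Tendsto (fun j => DiffuseDomain.H1.dist (u (σ j)) u₀) Filter.atTop (nhds 0) :=
  -- No extraction is needed, since the full sequence converges.
  ⟨id, strictMono_id,
    DiffuseDomain.Data.tendsto_dist_of_isDiffuseSolution hu₀ (fun k => (hε k).1) hε_lim hu⟩
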